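/- **Second order tangent bundles.** For a smooth manifold $X$ modelled on a Banach or Fréchet space, let $C_x$ be the set of smooth curves $f:(-\varepsilon,\varepsilon)\to X$, $\varepsilon>0$, with $f(0)=x$. Write $f\approx_x g$ if $f'(0)=g'(0)$ in $TX$ and $f''(0)=g''(0)$ in $T(TX)$, where $f'(t)=[df(t)](1)$ and $f''(t)=[df'(t)](1)$. Put $T^2_xX=C_x/\!\approx_x$, $T^2X=\bigcup_{x\in X}T^2_xX$, and let $[f,x]_2$ be the class of $f\in C_x$. If $X$ is modelled on a Fréchet space, $TX$ is the set of classes $[c,x]$ of smooth curves $c$ with $c(0)=x$, two curves being identified when they have the same point and the same derivative at $0$ in charts; its charts are $[c,x]\mapsto(\psi(x),(\psi\circ c)'(0))$, for the charts $\psi$ of $X$ around $x$, and $T(TX)$ is obtained by repeating this. **Setting.** Let $\{E^i;\rho^{ji}\}_{i,j\in\mathbb N}$ be a projective system of real Banach spaces and continuous linear maps $\rho^{ji}:E^j\to E^i$ $(j\ge i)$, with limit the Fréchet space $\mathbb F=\varprojlim E^i$. Let $\{M^i;\varphi^{ji}\}_{i,j\in\mathbb N}$ be a projective system of $C^\infty$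 manifolds $M^i$ modelled on $E^i$ and smooth maps $\varphi^{ji}:M^j\to M^i$ $(j\ge i)$. Let $M=\varprojlim M^i$, with the projective limit topology and the canonical projections $\varphi^i:M\to M^i$. Assume that every $x=(x^i)\in M$ lies in the domain of a projective limit chart, that is: there are charts $(U^i,\psi^i)$ of $M^i$ with $x^i\in U^i$, $\varphi^{ji}(U^j)\subseteq U^i$ and $\psi^i\circ\varphi^{ji}=\rho^{ji}\circ\psi^j$ on $U^j$ for $j\ge i$, such that $\varprojlim U^i$ is open in $M$ and $\varprojlim\psi^i$ maps it homeomorphically onto an open subset of $\mathbb F$. Thus $M$, with the charts $(\varprojlim U^i,\varprojlim\psi^i)$, is a Fréchet manifold modelled on $\mathbb F$. **Proposition.** The maps $$g^{ji}:T^2M^j\to T^2M^i,\qquad [f,x]_2\mapsto[\varphi^{ji}\circ f,\varphi^{ji}(x)]_2\qquad(j\ge i)$$ are well defined, and $\{T^2M^i;g^{ji}\}_{i,j\in\mathbb N}$ is a projective system, i.e. $g^{ii}=\mathrm{id}$ and $g^{ik}\circ g^{ji}=g^{jk}$ for $j\ge i\ge k$. The map $$F:T^2M\to\varprojlim T^2M^i,\qquad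 [f,x]_2\mapsto\big([\varphi^i\circ f,\varphi^i(x)]_2\big)_{i\in\mathbb N}$$ is well defined and bijective. -/

import Mathlib

open Set Filter Topology
open scoped Manifold ContDiff

noncomputable section

namespace SecondOrder

universe u v

/-! ### Smooth curves in a topological vector space -/

section TVS

variable {F : Type*} [AddCommGroup F] [Module ℝ F] [TopologicalSpace F]

/-- The curve `c` in the topological vector space `F` has derivative `v` at time `t`: the
difference quotients converge to `v`. -/
def HasCurveDerivAt (c : ℝ → F) (v : F) (t : ℝ) : Prop :=
  Tendsto (fun h : ℝ => h⁻¹ • (c (t + h) - c t)) (𝓝[≠] 0) (𝓝 v)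

/-- The derivative of the curve `c` at time `t` (meaningful when the difference quotients
converge; `F` is Hausdorff in all uses). -/
def curveDeriv (c : ℝ → F) (t : ℝ) : F :=
  @limUnder _ _ _ ⟨0⟩ (𝓝[≠] (0 : ℝ)) (fun h : ℝ => h⁻¹ • (c (t + h) - c t))

/-- The curve `c` is `C^∞` on the open set `s` of times: it has successive derivatives
`g 0 = c`, `g 1`, `g 2`, … of all orders on `s`. -/
def SmoothIn (c : ℝ → F) (s : Set ℝ) : Prop :=
  ∃ g : ℕ → ℝ → F, g 0 = c ∧ ∀ n, ∀ t ∈ s, HasCurveDerivAt (g n) (g (n + 1) t) t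

theorem HasCurveDerivAt.curveDeriv_eq [T2Space F] {c : ℝ → F} {v : F} {t : ℝ}
    (h : HasCurveDerivAt c v t) : curveDeriv c t = v :=
  @Tendsto.limUnder_eq _ _ _ _ _ _ _ _ h

theorem HasCurveDerivAt.congr {c d : ℝ → F} {v : F} {t : ℝ} (h : HasCurveDerivAt c v t)
    (hcd : d =ᶠ[𝓝 t] c) : HasCurveDerivAt d v t := by
  refine Tendsto.congr' ?_ h
  have h1 : Tendsto (fun r : ℝ => t + r) (𝓝[≠] 0) (𝓝 t) := by
    have : Tendsto (fun r : ℝ => t + r) (𝓝 0) (𝓝 (t + 0)) := by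
      exact (continuous_const.add continuous_id).tendsto 0
    simpa using this.mono_left (nhdsWithin_le_nhds (s := {0}ᶜ))
  filter_upwards [h1.eventually hcd] with r hr
  rw [hr, hcd.self_of_nhds]

theorem HasCurveDerivAt.prodMk {G : Type*} [AddCommGroup G] [Module ℝ G] [TopologicalSpace G]
    {c : ℝ → F} {d : ℝ → G} {v : F} {w : G} {t : ℝ}
    (h : HasCurveDerivAt c v t) (h' : HasCurveDerivAt d w t) :
    HasCurveDerivAt (fun s => (c s, d s)) (v, w) t :=
  Tendsto.prodMk_nhds h h'

theorem HasCurveDerivAt.shift {c : ℝ → F} {v : F} {t r : ℝ}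
    (h : HasCurveDerivAt c v (t + r)) : HasCurveDerivAt (fun s => c (t + s)) v r := by
  simpa only [HasCurveDerivAt, add_assoc] using h

theorem SmoothIn.mono {c : ℝ → F} {s s' : Set ℝ} (h : SmoothIn c s) (hs : s' ⊆ s) :
    SmoothIn c s' := by
  obtain ⟨g, h0, h1⟩ := h
  exact ⟨g, h0, fun n t ht => h1 n t (hs ht)⟩

end TVS

/-! ### Sets with an atlas, smooth curves and the tangent bundle

The tangent bundle of a manifold `X` modelled on a topological vector space `F` is the set of
equivalence classes of smooth curves. It carries charts with values in `F × F`, hence the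
construction can be repeated. A manifold enters only through its charts. -/

/-- A chart of `X` with values in `F`: its domain and its map (relevant only on the domain). -/
structure LocalChart (F : Type*) (X : Type*) where
  source : Set X
  toFun : X → F

section Atlas

variable {F : Type*} [AddCommGroup F] [Module ℝ F] [TopologicalSpace F] {X : Type*}

/-- A smooth curve `(-ε, ε) → X`, for the atlas `A` of `X` (values outside of `(-ε, ε)` are
irrelevant): at each time of `(-ε, ε)` and for each chart around the corresponding point, the
curve stays locally in the domain of the chart and its local representative is smooth. -/
structure SmoothCurve (A : Set (LocalChart F X)) where
  toFun : ℝ → X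
  ε : ℝ
  ε_pos : 0 < ε
  smooth : ∀ t ∈ Ioo (-ε) ε, ∀ e ∈ A, toFun t ∈ e.source →
    ∃ δ > 0, (∀ s ∈ Ioo (t - δ) (t + δ), toFun s ∈ e.source) ∧
      SmoothIn (e.toFun ∘ toFun) (Ioo (t - δ) (t + δ))

/-- Two curves are tangent at time `0` if they pass through the same point and have the same
derivative in the charts around this point. -/
def tangentSetoid (A : Set (LocalChart F X)) : Setoid (SmoothCurve A) where
  r c d := c.toFun 0 = d.toFun 0 ∧ ∀ e ∈ A, c.toFun 0 ∈ e.source →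
    curveDeriv (e.toFun ∘ c.toFun) 0 = curveDeriv (e.toFun ∘ d.toFun) 0
  iseqv :=
    { refl := fun _ => ⟨rfl, fun _ _ _ => rfl⟩
      symm := by
        rintro c d ⟨h, h'⟩
        exact ⟨h.symm, fun e he hd => (h' e he (h ▸ hd)).symm⟩
      trans := by
        rintro a b c ⟨h1, h1'⟩ ⟨h2, h2'⟩
        exact ⟨h1.trans h2, fun e he hc => (h1' e he hc).trans (h2' e he (h1 ▸ hc))⟩ }

/-- The tangent bundle `TX`: classes `[c, x]` of smooth curves `c` with `c 0 = x`. -/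
def Tangent (A : Set (LocalChart F X)) : Type _ := Quotient (tangentSetoid A)

/-- The tangent vector `[c, c 0]`. -/
def Tangent.mk {A : Set (LocalChart F X)} (c : SmoothCurve A) : Tangent A :=
  Quotient.mk (tangentSetoid A) c

/-- The foot point `x` of a tangent vector `[c, x]`. -/
def Tangent.proj {A : Set (LocalChart F X)} (p : Tangent A) : X :=
  Quotient.lift (fun c : SmoothCurve A => c.toFun 0) (fun c d (h : (tangentSetoid A).r c d) => h.1) p

open Classical in
/-- The chart `[c, x] ↦ (ψ x, (ψ ∘ c)' 0)` of `TX` over the domain of the chart `ψ` of `X`. -/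
def tangentChart {A : Set (LocalChart F X)} (e : LocalChart F X) (he : e ∈ A) :
    LocalChart (F × F) (Tangent A) where
  source := {p | p.proj ∈ e.source}
  toFun p := Quotient.lift
    (fun c : SmoothCurve A =>
      (e.toFun (c.toFun 0),
        if c.toFun 0 ∈ e.source then curveDeriv (e.toFun ∘ c.toFun) 0 else 0))
    (fun c d (h : (tangentSetoid A).r c d) => by
      by_cases hc : c.toFun 0 ∈ e.source
      · have hd : d.toFun 0 ∈ e.source := h.1 ▸ hc
        simp only [hd, if_true, h.1, h.2 e he hc]
      · have hd : d.toFun 0 ∉ e.source := h.1 ▸ hc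
        simp only [hd, if_false, h.1]) p

/-- The atlas of `TX` induced by the atlas `A` of `X`. -/
def tangentAtlas (A : Set (LocalChart F X)) : Set (LocalChart (F × F) (Tangent A)) :=
  {k | ∃ (e : LocalChart F X) (he : e ∈ A), k = tangentChart e he}

/-- The curve `s ↦ c (t + s)`, for a time `t` in the domain of `c`. -/
def SmoothCurve.shift {A : Set (LocalChart F X)} (c : SmoothCurve A) (t : ℝ)
    (ht : t ∈ Ioo (-c.ε) c.ε) : SmoothCurve A where
  toFun s := c.toFun (t + s)
  ε := c.ε - |t|
  ε_pos := by
    have := abs_lt.2 ht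
    linarith
  smooth := by
    intro r hr e he hce
    have h1 : t + r ∈ Ioo (-c.ε) c.ε := by
      have h2 := neg_abs_le t
      have h3 := le_abs_self t
      constructor <;> linarith [hr.1, hr.2]
    obtain ⟨δ, hδ, hs, g, hg0, hg⟩ := c.smooth (t + r) h1 e he hce
    refine ⟨δ, hδ, fun s hsr => hs (t + s) ⟨by linarith [hsr.1], by linarith [hsr.2]⟩,
      fun n s => g n (t + s), ?_, fun n s hsr => ?_⟩
    · funext s; exact congrFun hg0 (t + s)
    · exact (hg n (t + s) ⟨by linarith [hsr.1], by linarith [hsr.2]⟩).shift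

open Classical in
/-- The tangent chart read along the velocity of a curve. -/
theorem tangentChart_mk_shift {A : Set (LocalChart F X)} (c : SmoothCurve A) (t : ℝ)
    (ht : t ∈ Ioo (-c.ε) c.ε) (e : LocalChart F X) (he : e ∈ A) (h : c.toFun t ∈ e.source) :
    (tangentChart e he).toFun (Tangent.mk (c.shift t ht)) =
      (e.toFun (c.toFun t), curveDeriv (e.toFun ∘ c.toFun) t) := by
  have h0 : (c.shift t ht).toFun 0 = c.toFun t := by simp [SmoothCurve.shift]
  have h1 : curveDeriv (e.toFun ∘ (c.shift t ht).toFun) 0 =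
      curveDeriv (e.toFun ∘ c.toFun) t := by
    simp [curveDeriv, SmoothCurve.shift]
  change (e.toFun ((c.shift t ht).toFun 0), if (c.shift t ht).toFun 0 ∈ e.source then
    curveDeriv (e.toFun ∘ (c.shift t ht).toFun) 0 else 0) = _
  rw [h1, h0, if_pos h]

open Classical in
/-- The first derivative `c' : (-ε, ε) → TX` of a smooth curve `c`, itself a smooth curve:
`c' t` is the class of `s ↦ c (t + s)`. -/
def SmoothCurve.velocity [T2Space F] {A : Set (LocalChart F X)} (c : SmoothCurve A) :
    SmoothCurve (tangentAtlas A) where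
  toFun t := if ht : t ∈ Ioo (-c.ε) c.ε then Tangent.mk (c.shift t ht) else Tangent.mk c
  ε := c.ε
  ε_pos := c.ε_pos
  smooth := by
    rintro t ht k ⟨e, he, rfl⟩ hk
    simp only [ht, dite_true] at hk
    have hproj : ∀ s (hs : s ∈ Ioo (-c.ε) c.ε),
        (Tangent.mk (c.shift s hs)).proj = c.toFun s := by
      intro s hs
      change (c.shift s hs).toFun 0 = _
      simp [SmoothCurve.shift]
    have hce : c.toFun t ∈ e.source := by
      rw [← hproj t ht]; exact hk
    obtain ⟨δ, hδ, hs, g, hg0, hg⟩ := c.smooth t ht e he hce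
    have hη : 0 < min δ (c.ε - |t|) := lt_min hδ (by linarith [abs_lt.2 ht])
    have hin : ∀ s ∈ Ioo (t - min δ (c.ε - |t|)) (t + min δ (c.ε - |t|)),
        s ∈ Ioo (-c.ε) c.ε ∧ s ∈ Ioo (t - δ) (t + δ) := by
      intro s hs
      have h1 := min_le_left δ (c.ε - |t|)
      have h2 := min_le_right δ (c.ε - |t|)
      have h3 := neg_abs_le t
      have h4 := le_abs_self t
      exact ⟨⟨by linarith [hs.1], by linarith [hs.2]⟩, ⟨by linarith [hs.1], by linarith [hs.2]⟩⟩
    refine ⟨_, hη, fun s hsη => ?_, ?_⟩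
    · rw [dif_pos (hin s hsη).1]
      change (Tangent.mk (c.shift s _)).proj ∈ e.source
      rw [hproj]
      exact hs s (hin s hsη).2
    · refine ⟨fun n => if n = 0 then _ else fun s => (g n s, g (n + 1) s), if_pos rfl,
        fun n s hsη => ?_⟩
      have key : HasCurveDerivAt (fun s => (g n s, g (n + 1) s)) (g (n + 1) s, g (n + 2) s) s :=
        (hg n s (hin s hsη).2).prodMk (hg (n + 1) s (hin s hsη).2)
      rcases n with _ | n
      · simp only [if_true, zero_add, one_ne_zero, if_false]
        refine key.congr ?_
        filter_upwards [isOpen_Ioo.mem_nhds hsη] with r hr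
        have hr' := hin r hr
        simp only [Function.comp_apply]
        rw [dif_pos hr'.1, tangentChart_mk_shift c r hr'.1 e he (hs r hr'.2)]
        have := (hg 0 r hr'.2).curveDeriv_eq
        rw [hg0] at this
        rw [this, hg0]
        rfl
      · simpa using key

/-- The relation `f ≈ g` of having, at time `0`, the same value, the same first derivative (in
`TX`) and the same second derivative (in `T(TX)`). -/
def secondSetoid [T2Space F] (A : Set (LocalChart F X)) : Setoid (SmoothCurve A) where
  r c d := c.velocity.toFun 0 = d.velocity.toFun 0 ∧
    c.velocity.velocity.toFun 0 = d.velocity.velocity.toFun 0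
  iseqv :=
    { refl := fun _ => ⟨rfl, rfl⟩
      symm := fun h => ⟨h.1.symm, h.2.symm⟩
      trans := fun h h' => ⟨h.1.trans h'.1, h.2.trans h'.2⟩ }

/-- The second order tangent bundle `T²X`. Equivalent curves have the same value at `0`, so that
`T²X` is the disjoint union over `x` of the sets of classes of curves through `x`. -/
def SecondTangent [T2Space F] (A : Set (LocalChart F X)) : Type _ := Quotient (secondSetoid A)

/-- The class `[c, c 0]₂`. -/
def SecondTangent.mk [T2Space F] {A : Set (LocalChart F X)} (c : SmoothCurve A) :
    SecondTangent A := Quotient.mk (secondSetoid A) c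

end Atlas

/-! ### The second order tangent bundle of a Banach manifold -/

section Banach

variable (E : Type u) [NormedAddCommGroup E] [NormedSpace ℝ E]
  (M : Type v) [TopologicalSpace M] [ChartedSpace E M]

/-- A smooth curve `(-ε, ε) → M` in a Banach manifold (values outside of `(-ε, ε)` are
irrelevant). -/
structure BanachCurve where
  toFun : ℝ → M
  ε : ℝ
  ε_pos : 0 < ε
  smooth : ContMDiffOn 𝓘(ℝ, ℝ) 𝓘(ℝ, E) ∞ toFun (Ioo (-ε) ε)

variable {E M}

/-- The image of a smooth curve under a smooth map. -/
def BanachCurve.map {E' : Type u} [NormedAddCommGroup E'] [NormedSpace ℝ E'] {M' : Type v}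
    [TopologicalSpace M'] [ChartedSpace E' M'] (c : BanachCurve E M) (f : M → M')
    (hf : ContMDiff 𝓘(ℝ, E) 𝓘(ℝ, E') ∞ f) : BanachCurve E' M' where
  toFun := f ∘ c.toFun
  ε := c.ε
  ε_pos := c.ε_pos
  smooth := hf.comp_contMDiffOn c.smooth

variable [IsManifold 𝓘(ℝ, E) ∞ M]

/-- The first derivative `t ↦ [df(t)](1)`, a curve in `TM`. -/
def BanachCurve.velocity (c : BanachCurve E M) (t : ℝ) : TangentBundle 𝓘(ℝ, E) M :=
  ⟨c.toFun t, mfderiv 𝓘(ℝ, ℝ) 𝓘(ℝ, E) c.toFun t (1 : ℝ)⟩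

/-- The second derivative `t ↦ [df'(t)](1)`, a curve in `T(TM)`. -/
def BanachCurve.acceleration (c : BanachCurve E M) (t : ℝ) :
    TangentBundle 𝓘(ℝ, E).tangent (TangentBundle 𝓘(ℝ, E) M) :=
  ⟨c.velocity t, mfderiv 𝓘(ℝ, ℝ) 𝓘(ℝ, E).tangent c.velocity t (1 : ℝ)⟩

variable (E M)

/-- The relation `f ≈ g` of having, at time `0`, the same value, the same first derivative (in
`TM`) and the same second derivative (in `T(TM)`). -/
def banachSecondSetoid : Setoid (BanachCurve E M) where
  r c d := c.velocity 0 = d.velocity 0 ∧ c.acceleration 0 = d.acceleration 0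
  iseqv :=
    { refl := fun _ => ⟨rfl, rfl⟩
      symm := fun h => ⟨h.1.symm, h.2.symm⟩
      trans := fun h h' => ⟨h.1.trans h'.1, h.2.trans h'.2⟩ }

/-- The second order tangent bundle `T²M` of a Banach manifold. Equivalent curves have the same
value at `0`, so that `T²M` is the disjoint union over `x` of the sets of classes of curves
through `x`. -/
def BanachSecondTangent : Type _ := Quotient (banachSecondSetoid E M)

variable {E M}

/-- The class `[c, c 0]₂`. -/
def BanachSecondTangent.mk (c : BanachCurve E M) : BanachSecondTangent E M :=
  Quotient.mk (banachSecondSetoid E M) c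

end Banach

/-! ### Projective limits of Banach manifolds -/

/-- The projective limit of a system of sets. -/
def projLimit {X : ℕ → Type*} (f : ∀ ⦃i j : ℕ⦄, i ≤ j → X j → X i) : Set (∀ i, X i) :=
  {x | ∀ ⦃i j : ℕ⦄ (h : i ≤ j), f h (x j) = x i}

section Limit

variable {E : ℕ → Type u} [∀ i, NormedAddCommGroup (E i)] [∀ i, NormedSpace ℝ (E i)]
  {M : ℕ → Type v} [∀ i, TopologicalSpace (M i)] [∀ i, ChartedSpace (E i) (M i)]

/-- The Fréchet space `𝔽 = lim E i`, with the topology of the product. -/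
def modelLimit (ρ : ∀ ⦃i j : ℕ⦄, i ≤ j → E j →L[ℝ] E i) : Submodule ℝ (∀ i, E i) where
  carrier := projLimit fun _ _ h => ρ h
  add_mem' hx hy _ _ h := by simp [hx h, hy h]
  zero_mem' _ _ h := by simp
  smul_mem' a x hx _ _ h := by simp [hx h]

/-- The projective limit charts `(lim U i, lim ψ i)` of `lim M i`: the `(U i, ψ i)` form a
projective system of charts of the `M i`, the set `lim U i` is open in `lim M i`, and
`lim ψ i` maps it homeomorphically onto an open subset of `𝔽`. -/
def limitCharts (ρ : ∀ ⦃i j : ℕ⦄, i ≤ j → E j →L[ℝ] E i)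
    (φ : ∀ ⦃i j : ℕ⦄, i ≤ j → M j → M i) :
    Set (OpenPartialHomeomorph (projLimit φ) (modelLimit ρ)) :=
  {e | ∃ ψ : ∀ i, OpenPartialHomeomorph (M i) (E i),
    (∀ i, ψ i ∈ IsManifold.maximalAtlas 𝓘(ℝ, E i) ∞ (M i)) ∧
    (∀ ⦃i j : ℕ⦄ (h : i ≤ j), ∀ y ∈ (ψ j).source,
      φ h y ∈ (ψ i).source ∧ ψ i (φ h y) = ρ h (ψ j y)) ∧
    (∀ x, x ∈ e.source ↔ ∀ i, x.1 i ∈ (ψ i).source) ∧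
    ∀ x ∈ e.source, ∀ i, (e x).1 i = ψ i (x.1 i)}

/-- The atlas of `M = lim M i` consisting of all projective limit charts. -/
def limitAtlas (ρ : ∀ ⦃i j : ℕ⦄, i ≤ j → E j →L[ℝ] E i)
    (φ : ∀ ⦃i j : ℕ⦄, i ≤ j → M j → M i) : Set (LocalChart (modelLimit ρ) (projLimit φ)) :=
  {k | ∃ e ∈ limitCharts ρ φ, k = ⟨e.source, e⟩}

/-- The Banach manifolds `M i`, modelled on the Banach spaces `E i`, form together with the
connecting maps `φ`, `ρ` a projective system whose limit is a Fréchet manifold: the limit is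
covered by projective limit charts. -/
structure IsManifoldSystem (ρ : ∀ ⦃i j : ℕ⦄, i ≤ j → E j →L[ℝ] E i)
    (φ : ∀ ⦃i j : ℕ⦄, i ≤ j → M j → M i) : Prop where
  model_system : InverseSystem (F := E) (fun _ _ h => ρ h)
  system : InverseSystem (F := M) φ
  smooth : ∀ ⦃i j : ℕ⦄ (h : i ≤ j), ContMDiff 𝓘(ℝ, E j) 𝓘(ℝ, E i) ∞ (φ h)
  exists_chart : ∀ x : projLimit φ, ∃ e ∈ limitCharts ρ φ, x ∈ e.source

theorem SmoothIn.contDiffOn {G : Type*} [NormedAddCommGroup G] [NormedSpace ℝ G] {c : ℝ → G}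
    {a b : ℝ} (h : SmoothIn c (Ioo a b)) : ContDiffOn ℝ ∞ c (Ioo a b) := by
  obtain ⟨g, rfl, hg⟩ := h
  have hd : ∀ n, ∀ t ∈ Ioo a b, HasDerivAt (g n) (g (n + 1) t) t := fun n t ht =>
    hasDerivAt_iff_tendsto_slope_zero.2 (hg n t ht)
  rw [contDiffOn_infty]
  intro m
  have : ∀ (m k : ℕ), ContDiffOn ℝ m (g k) (Ioo a b) := by
    intro m
    induction m with
    | zero =>
      intro k
      exact contDiffOn_zero.2 fun t ht => (hd k t ht).continuousAt.continuousWithinAt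
    | succ m ih =>
      intro k
      rw [Nat.cast_succ, contDiffOn_succ_iff_deriv_of_isOpen isOpen_Ioo]
      refine ⟨fun t ht => (hd k t ht).differentiableAt.differentiableWithinAt, by simp, ?_⟩
      exact (ih (k + 1)).congr fun t ht => (hd k t ht).deriv
  exact this m 0

/-- The `i`-th coordinate of a smooth curve of `𝔽` is smooth. -/
theorem SmoothIn.coord {ρ : ∀ ⦃i j : ℕ⦄, i ≤ j → E j →L[ℝ] E i} {c : ℝ → modelLimit ρ}
    {s : Set ℝ} (h : SmoothIn c s) (i : ℕ) : SmoothIn (fun t => (c t).1 i) s := by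
  obtain ⟨g, rfl, hg⟩ := h
  refine ⟨fun n t => (g n t).1 i, rfl, fun n t ht => ?_⟩
  have h1 : Continuous fun x : modelLimit ρ => x.1 i :=
    (continuous_apply i).comp continuous_subtype_val
  exact (h1.tendsto _).comp (hg n t ht)

/-- The curve `φ i ∘ c` of `M i`, where `φ i : lim M i → M i` is the canonical projection and `c`
is a smooth curve of `lim M i`. -/
def SmoothCurve.component [∀ i, IsManifold 𝓘(ℝ, E i) ∞ (M i)]
    {ρ : ∀ ⦃i j : ℕ⦄, i ≤ j → E j →L[ℝ] E i}
    {φ : ∀ ⦃i j : ℕ⦄, i ≤ j → M j → M i} (hM : IsManifoldSystem ρ φ)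
    (c : SmoothCurve (limitAtlas ρ φ)) (i : ℕ) : BanachCurve (E i) (M i) where
  toFun t := (c.toFun t).1 i
  ε := c.ε
  ε_pos := c.ε_pos
  smooth := by
    intro t ht
    obtain ⟨e, he, hte⟩ := hM.exists_chart (c.toFun t)
    obtain ⟨δ, hδ, hs, hsm⟩ := c.smooth t ht ⟨e.source, e⟩ ⟨e, he, rfl⟩ hte
    obtain ⟨ψ, hψ, -, hsrc, hval⟩ := he
    have h1 : ContDiffOn ℝ ∞ (fun s => ((e (c.toFun s) : modelLimit ρ) : ∀ i, E i) i)
        (Ioo (t - δ) (t + δ)) := (hsm.coord i).contDiffOn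
    have h2 := (contMDiffOn_symm_of_mem_maximalAtlas (hψ i)).comp h1.contMDiffOn (fun s hs' => by
      change ((e (c.toFun s) : modelLimit ρ) : ∀ i, E i) i ∈ (ψ i).target
      rw [hval _ (hs s hs') i]
      exact (ψ i).map_source ((hsrc _).1 (hs s hs') i))
    have h3 : ContMDiffOn 𝓘(ℝ, ℝ) 𝓘(ℝ, E i) ∞ (fun s => (c.toFun s).1 i)
        (Ioo (t - δ) (t + δ)) := h2.congr fun s hs' => by
      simp only [Function.comp_apply]
      rw [hval _ (hs s hs') i, (ψ i).left_inv ((hsrc _).1 (hs s hs') i)]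
    exact (h3.contMDiffAt (isOpen_Ioo.mem_nhds ⟨by linarith, by linarith⟩)).contMDiffWithinAt

end Limit

end SecondOrder

end

/-! A class in a second order tangent bundle is a 2-jet. Read in a chart it amounts to three
vectors: the value, the first and the second derivative at `0`. For Banach manifolds this is
`acc_eq_iff_chart`, obtained from the functoriality of `T(T·)` under smooth maps (`acc_comp`), which
also makes the maps `g` well defined. For curve-defined tangent bundles it is
`SecondTangent.mk_eq_iff`.

In a projective limit chart, derivatives are computed coordinate by coordinate, since `𝔽` carries
the topology induced by the product. Hence two curves of the limit are equivalent exactly when all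
their components are (`SecondTangent.mk_eq_iff_component`): one implication makes `F` well defined,
the other makes it injective.

For surjectivity, representatives `c i` of a compatible family need not be compatible as curves, and
their intervals may shrink to a point as `i` grows, so they have no limit curve. Their 2-jets at
`0`, read in a limit chart, are compatible and give `e x`, `v₁`, `v₂` in `𝔽`. The curve `e x + t v₁
+ (t²/2) v₂`, pulled back by the chart, represents the family (`exists_smoothCurve_component_eq`).
-/

namespace SecondOrder

/-! ### Velocities of curves and the chain rule -/

section Velocity

variable {E : Type*} [NormedAddCommGroup E] [NormedSpace ℝ E] {H : Type*} [TopologicalSpace H]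
  {I : ModelWithCorners ℝ E H} {M : Type*} [TopologicalSpace M] [ChartedSpace H M]
  {E' : Type*} [NormedAddCommGroup E'] [NormedSpace ℝ E'] {H' : Type*} [TopologicalSpace H']
  {I' : ModelWithCorners ℝ E' H'} {M' : Type*} [TopologicalSpace M'] [ChartedSpace H' M']

/-- The velocity of a curve in a manifold with arbitrary model. -/
noncomputable def vel (I : ModelWithCorners ℝ E H) [IsManifold I 1 M] (c : ℝ → M) (t : ℝ) : TangentBundle I M :=
  ⟨c t, mfderiv 𝓘(ℝ, ℝ) I c t (1 : ℝ)⟩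

theorem contMDiffOn_tangentMap [IsManifold I 1 M] [IsManifold I' 1 M'] {f : M → M'} {s : Set M}
    (hf : ContMDiffOn I I' ∞ f s) (hs : IsOpen s) :
    ContMDiffOn I.tangent I'.tangent ∞ (tangentMap I I' f)
      (Bundle.TotalSpace.proj ⁻¹' s) := by
  refine (hf.contMDiffOn_tangentMapWithin (m := ∞) (by simp) hs.uniqueMDiffOn).congr ?_
  intro p hp
  simp only [tangentMap, tangentMapWithin]
  rw [mfderivWithin_of_isOpen hs hp]

theorem _root_.ContMDiffOn.mdifferentiableAt_of_isOpen {f : M → M'} {s : Set M}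
    (hf : ContMDiffOn I I' ∞ f s) (hs : IsOpen s) {x : M} (hx : x ∈ s) :
    MDifferentiableAt I I' f x :=
  (hf.contMDiffAt (hs.mem_nhds hx)).mdifferentiableAt (by simp)

variable [IsManifold I 1 M] [IsManifold I' 1 M']

theorem vel_congr {c d : ℝ → M} {t : ℝ} (h : c =ᶠ[𝓝 t] d) : vel I c t = vel I d t := by
  have h1 := h.mfderiv_eq (I := 𝓘(ℝ, ℝ)) (I' := I)
  have h0 := h.self_of_nhds
  simp only [vel]
  congr 1
  exact congrArg (fun L : ℝ →L[ℝ] E => L 1) h1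

theorem vel_eventuallyEq {c d : ℝ → M} {t : ℝ} (h : c =ᶠ[𝓝 t] d) :
    vel I c =ᶠ[𝓝 t] vel I d := by
  filter_upwards [h.eventuallyEq_nhds] with s hs using vel_congr hs

theorem vel_comp {c : ℝ → M} {f : M → M'} {t : ℝ} (hf : MDifferentiableAt I I' f (c t))
    (hc : MDifferentiableAt 𝓘(ℝ, ℝ) I c t) :
    vel I' (f ∘ c) t = tangentMap I I' f (vel I c t) :=
  tangentMap_comp_at (⟨t, (1 : ℝ)⟩ : TangentBundle 𝓘(ℝ, ℝ) ℝ) hf hc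

/-- The velocity is the tangent map of `c` composed with the smooth section `t ↦ (t, 1)` of `Tℝ`. -/
theorem contMDiffOn_vel {c : ℝ → M} {u : Set ℝ} (hu : IsOpen u)
    (hc : ContMDiffOn 𝓘(ℝ, ℝ) I ∞ c u) : ContMDiffOn 𝓘(ℝ, ℝ) I.tangent ∞ (vel I c) u := by
  have h1 : ContMDiff 𝓘(ℝ, ℝ) 𝓘(ℝ, ℝ).tangent ∞
      (fun t : ℝ => (tangentBundleModelSpaceHomeomorph 𝓘(ℝ, ℝ)).symm (t, (1 : ℝ))) := by
    have h2 : ContMDiff 𝓘(ℝ, ℝ) (𝓘(ℝ, ℝ).prod 𝓘(ℝ, ℝ)) ∞ (fun t : ℝ => (t, (1 : ℝ))) :=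
      contMDiff_id.prodMk contMDiff_const
    rw [chartedSpaceSelf_prod] at h2
    exact contMDiff_tangentBundleModelSpaceHomeomorph_symm.comp h2
  exact (contMDiffOn_tangentMap hc hu).comp h1.contMDiffOn fun t ht => ht

end Velocity

/-! ### Accelerations in Banach manifolds and their expression in charts -/

section Acceleration

variable {E : Type*} [NormedAddCommGroup E] [NormedSpace ℝ E]
  {M : Type*} [TopologicalSpace M] [ChartedSpace E M] [IsManifold 𝓘(ℝ, E) ∞ M]
  {E' : Type*} [NormedAddCommGroup E'] [NormedSpace ℝ E']
  {M' : Type*} [TopologicalSpace M'] [ChartedSpace E' M'] [IsManifold 𝓘(ℝ, E') ∞ M']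

variable (E) in
/-- The acceleration of a curve in a Banach manifold: the velocity of its velocity. -/
noncomputable def acc (c : ℝ → M) (t : ℝ) : TangentBundle 𝓘(ℝ, E).tangent (TangentBundle 𝓘(ℝ, E) M) :=
  vel 𝓘(ℝ, E).tangent (vel 𝓘(ℝ, E) c) t

theorem acc_congr {c d : ℝ → M} {t : ℝ} (h : c =ᶠ[𝓝 t] d) : acc E c t = acc E d t :=
  vel_congr (vel_eventuallyEq h)

/-- The chain rule applied twice. The first application must hold on a neighbourhood of `t`, because
its result is differentiated again. -/
theorem acc_comp {c : ℝ → M} {u : Set ℝ} (hu : IsOpen u) (hc : ContMDiffOn 𝓘(ℝ, ℝ) 𝓘(ℝ, E) ∞ c u)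
    {f : M → M'} {s : Set M} (hs : IsOpen s) (hf : ContMDiffOn 𝓘(ℝ, E) 𝓘(ℝ, E') ∞ f s)
    {t : ℝ} (ht : t ∈ u) (hts : c t ∈ s) :
    acc E' (f ∘ c) t = tangentMap 𝓘(ℝ, E).tangent 𝓘(ℝ, E').tangent
      (tangentMap 𝓘(ℝ, E) 𝓘(ℝ, E') f) (acc E c t) := by
  have h1 : vel 𝓘(ℝ, E') (f ∘ c) =ᶠ[𝓝 t] tangentMap 𝓘(ℝ, E) 𝓘(ℝ, E') f ∘ vel 𝓘(ℝ, E) c := by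
    have hcont : ContinuousAt c t := (hc.continuousOn).continuousAt (hu.mem_nhds ht)
    filter_upwards [hu.mem_nhds ht, hcont (hs.mem_nhds hts)] with r hr hrs
    exact vel_comp (hf.mdifferentiableAt_of_isOpen hs hrs) (hc.mdifferentiableAt_of_isOpen hu hr)
  have hs' : IsOpen (Bundle.TotalSpace.proj ⁻¹' s : Set (TangentBundle 𝓘(ℝ, E) M)) :=
    hs.preimage (FiberBundle.continuous_proj E (TangentSpace 𝓘(ℝ, E) : M → Type _))
  rw [acc, vel_congr h1]
  exact vel_comp ((contMDiffOn_tangentMap hf hs).mdifferentiableAt_of_isOpen hs' hts)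
    ((contMDiffOn_vel hu hc).mdifferentiableAt_of_isOpen hu ht)

/-- The trivialization `T : TE ≃ E × E` turns the velocity of `c` into `q c = (c, c')`, whose own
velocity is `((c, c'), (c', c''))`. The tangent maps of `T` and `T.symm` carry this data to and from
`acc E c t`, and each gives one implication. -/
theorem acc_eq_iff {c d : ℝ → E} {u : Set ℝ} (hu : IsOpen u) (hc : ContDiffOn ℝ ∞ c u)
    (hd : ContDiffOn ℝ ∞ d u) {t : ℝ} (ht : t ∈ u) :
    acc E c t = acc E d t ↔
      c t = d t ∧ deriv c t = deriv d t ∧ deriv (deriv c) t = deriv (deriv d) t := by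
  let J := (𝓘(ℝ, E)).tangent
  let q : (ℝ → E) → ℝ → ModelProd E E := fun c s => (c s, deriv c s)
  let T := tangentBundleModelSpaceHomeomorph 𝓘(ℝ, E)
  have hvel : ∀ c : ℝ → E, vel 𝓘(ℝ, E) c = T.symm ∘ q c := by
    intro c
    funext s
    simp only [vel, mfderiv_eq_fderiv]
    rfl
  have hdiff : ∀ c : ℝ → E, ContDiffOn ℝ ∞ c u →
      DifferentiableAt ℝ c t ∧ DifferentiableAt ℝ (deriv c) t := by
    intro c hc
    refine ⟨(hc.contDiffAt (hu.mem_nhds ht)).differentiableAt (by simp), ?_⟩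
    have : ContDiffOn ℝ ∞ (deriv c) u := ((contDiffOn_infty_iff_deriv_of_isOpen hu).1 hc).2
    exact (this.contDiffAt (hu.mem_nhds ht)).differentiableAt (by simp)
  have hq : ∀ c : ℝ → E, ContDiffOn ℝ ∞ c u → MDifferentiableAt 𝓘(ℝ, ℝ) J (q c) t := by
    intro c hc
    have := (hdiff c hc).1.mdifferentiableAt.prodMk (hdiff c hc).2.mdifferentiableAt
    rw [chartedSpaceSelf_prod] at this
    exact this
  have hvq : ∀ c : ℝ → E, ContDiffOn ℝ ∞ c u →
      vel J (q c) t = ⟨(c t, deriv c t), (deriv c t, deriv (deriv c) t)⟩ := by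
    intro c hc
    have := mfderiv_prodMk (hdiff c hc).1.mdifferentiableAt (hdiff c hc).2.mdifferentiableAt
    rw [chartedSpaceSelf_prod] at this
    simp only [vel]
    congr 1
    refine (congrArg (fun L : ℝ →L[ℝ] E × E => L 1) this).trans ?_
    simp only [mfderiv_eq_fderiv]
    rfl
  have hTs : MDifferentiable J (𝓘(ℝ, E)).tangent T.symm :=
    (contMDiff_tangentBundleModelSpaceHomeomorph_symm (n := ∞)).mdifferentiable (by simp)
  have hT : MDifferentiable (𝓘(ℝ, E)).tangent J T :=
    (contMDiff_tangentBundleModelSpaceHomeomorph (n := ∞)).mdifferentiable (by simp)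
  have h1 : ∀ c : ℝ → E, ContDiffOn ℝ ∞ c u →
      acc E c t = tangentMap J (𝓘(ℝ, E)).tangent T.symm (vel J (q c) t) := by
    intro c hc
    rw [acc, hvel]
    exact vel_comp (hTs _) (hq c hc)
  have h2 : ∀ c : ℝ → E, ContDiffOn ℝ ∞ c u →
      vel J (q c) t = tangentMap (𝓘(ℝ, E)).tangent J T (acc E c t) := by
    intro c hc
    have : q c = T ∘ vel 𝓘(ℝ, E) c := by
      rw [hvel]; funext s; simp
    rw [acc, this]
    refine vel_comp (hT _) ?_
    rw [hvel]
    exact (hTs _).comp t (hq c hc)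
  constructor
  · intro h
    have h3 : vel J (q c) t = vel J (q d) t := by rw [h2 c hc, h2 d hd, h]
    rw [hvq c hc, hvq d hd] at h3
    have h4 := congrArg (fun p : TangentBundle J (ModelProd E E) => p.1) h3
    have h5 : ((deriv c t, deriv (deriv c) t) : E × E) = (deriv d t, deriv (deriv d) t) :=
      congrArg (fun p : TangentBundle J (ModelProd E E) => (p.2 : E × E)) h3
    exact ⟨congrArg Prod.fst h4, congrArg Prod.snd h4, congrArg Prod.snd h5⟩
  · rintro ⟨e1, e2, e3⟩
    rw [h1 c hc, h1 d hd, hvq c hc, hvq d hd, e1, e2, e3]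

/-- Two curves through the same point have the same acceleration if and only if their
representatives in a chart have the same derivatives up to order two. -/
theorem acc_eq_iff_chart {ψ : OpenPartialHomeomorph M E}
    (hψ : ψ ∈ IsManifold.maximalAtlas 𝓘(ℝ, E) ∞ M) {c d : ℝ → M} {u : Set ℝ} (hu : IsOpen u)
    (hc : ContMDiffOn 𝓘(ℝ, ℝ) 𝓘(ℝ, E) ∞ c u) (hd : ContMDiffOn 𝓘(ℝ, ℝ) 𝓘(ℝ, E) ∞ d u) {t : ℝ}
    (ht : t ∈ u) (hct : c t ∈ ψ.source) (hcd : c t = d t) :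
    acc E c t = acc E d t ↔ deriv (ψ ∘ c) t = deriv (ψ ∘ d) t ∧
      deriv (deriv (ψ ∘ c)) t = deriv (deriv (ψ ∘ d)) t := by
  have hdt : d t ∈ ψ.source := hcd ▸ hct
  have hψ1 := contMDiffOn_of_mem_maximalAtlas hψ
  have hψ2 := contMDiffOn_symm_of_mem_maximalAtlas hψ
  have hcu := hc.continuousOn.isOpen_inter_preimage hu ψ.open_source
  have hdu := hd.continuousOn.isOpen_inter_preimage hu ψ.open_source
  -- Times at which both curves stay in the domain of the chart.
  let w := (u ∩ c ⁻¹' ψ.source) ∩ (u ∩ d ⁻¹' ψ.source)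
  have hw : IsOpen w := hcu.inter hdu
  have htw : t ∈ w := ⟨⟨ht, hct⟩, ⟨ht, hdt⟩⟩
  have hψc : ContMDiffOn 𝓘(ℝ, ℝ) 𝓘(ℝ, E) ∞ (ψ ∘ c) w :=
    hψ1.comp (hc.mono fun s hs => hs.1.1) fun s hs => hs.1.2
  have hψd : ContMDiffOn 𝓘(ℝ, ℝ) 𝓘(ℝ, E) ∞ (ψ ∘ d) w :=
    hψ1.comp (hd.mono fun s hs => hs.2.1) fun s hs => hs.2.2
  have key := acc_eq_iff hw (contMDiffOn_iff_contDiffOn.1 hψc) (contMDiffOn_iff_contDiffOn.1 hψd) htw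
  have h0 : (ψ ∘ c) t = (ψ ∘ d) t := congrArg ψ hcd
  rw [← and_iff_right (b := deriv (ψ ∘ c) t = deriv (ψ ∘ d) t ∧ _) h0, ← key]
  constructor
  · intro h
    rw [acc_comp hu hc ψ.open_source hψ1 ht hct, acc_comp hu hd ψ.open_source hψ1 ht hdt, h]
  · intro h
    -- Near `t` each curve is recovered from its representative by `ψ.symm`, so functoriality
    -- carries the equality back.
    have hc' : c =ᶠ[𝓝 t] ψ.symm ∘ (ψ ∘ c) := by
      filter_upwards [hw.mem_nhds htw] with s hs
      exact (ψ.left_inv hs.1.2).symm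
    have hd' : d =ᶠ[𝓝 t] ψ.symm ∘ (ψ ∘ d) := by
      filter_upwards [hw.mem_nhds htw] with s hs
      exact (ψ.left_inv hs.2.2).symm
    rw [acc_congr hc', acc_congr hd', acc_comp hw hψc ψ.open_target hψ2 htw (ψ.map_source hct),
      acc_comp hw hψd ψ.open_target hψ2 htw (ψ.map_source hdt), h]

end Acceleration

/-! ### Classes of curves in a Banach manifold -/

section Curves

variable {E : Type*} [NormedAddCommGroup E] [NormedSpace ℝ E]
  {M : Type*} [TopologicalSpace M] [ChartedSpace E M]

theorem BanachCurve.zero_mem (c : BanachCurve E M) : (0 : ℝ) ∈ Ioo (-c.ε) c.ε :=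
  ⟨neg_lt_zero.2 c.ε_pos, c.ε_pos⟩

variable [IsManifold 𝓘(ℝ, E) ∞ M]

/-- The foot point of the acceleration is the velocity, so equal accelerations force equal
velocities. -/
theorem BanachSecondTangent.mk_eq_iff {c d : BanachCurve E M} :
    BanachSecondTangent.mk c = BanachSecondTangent.mk d ↔ acc E c.toFun 0 = acc E d.toFun 0 := by
  refine Quotient.eq.trans ⟨fun h => h.2, fun h => ⟨?_, h⟩⟩
  exact congrArg (fun p : TangentBundle 𝓘(ℝ, E).tangent (TangentBundle 𝓘(ℝ, E) M) => p.1) h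

theorem BanachSecondTangent.mk_eq_iff_chart {ψ : OpenPartialHomeomorph M E}
    (hψ : ψ ∈ IsManifold.maximalAtlas 𝓘(ℝ, E) ∞ M) {c d : BanachCurve E M}
    (hc : c.toFun 0 ∈ ψ.source) (hcd : c.toFun 0 = d.toFun 0) :
    BanachSecondTangent.mk c = BanachSecondTangent.mk d ↔
      deriv (ψ ∘ c.toFun) 0 = deriv (ψ ∘ d.toFun) 0 ∧
      deriv (deriv (ψ ∘ c.toFun)) 0 = deriv (deriv (ψ ∘ d.toFun)) 0 := by
  rw [BanachSecondTangent.mk_eq_iff]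
  exact acc_eq_iff_chart hψ (isOpen_Ioo.inter isOpen_Ioo) (c.smooth.mono inter_subset_left)
    (d.smooth.mono inter_subset_right)
    ⟨c.zero_mem, d.zero_mem⟩ hc hcd

theorem BanachSecondTangent.toFun_zero_eq {c d : BanachCurve E M}
    (h : BanachSecondTangent.mk c = BanachSecondTangent.mk d) : c.toFun 0 = d.toFun 0 :=
  congrArg (fun p : TangentBundle 𝓘(ℝ, E).tangent (TangentBundle 𝓘(ℝ, E) M) => p.1.1)
    (BanachSecondTangent.mk_eq_iff.1 h)

end Curves

/-! ### Functoriality of the second order tangent bundle -/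

section MapSecondTangent

universe u v

variable {E : Type u} [NormedAddCommGroup E] [NormedSpace ℝ E]
  {M : Type v} [TopologicalSpace M] [ChartedSpace E M] [IsManifold 𝓘(ℝ, E) ∞ M]
  {E' : Type u} [NormedAddCommGroup E'] [NormedSpace ℝ E']
  {M' : Type v} [TopologicalSpace M'] [ChartedSpace E' M'] [IsManifold 𝓘(ℝ, E') ∞ M']

theorem BanachSecondTangent.mk_map_eq {c d : BanachCurve E M}
    (h : BanachSecondTangent.mk c = BanachSecondTangent.mk d) (f : M → M')
    (hf : ContMDiff 𝓘(ℝ, E) 𝓘(ℝ, E') ∞ f) :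
    BanachSecondTangent.mk (c.map f hf) = BanachSecondTangent.mk (d.map f hf) := by
  rw [BanachSecondTangent.mk_eq_iff] at h ⊢
  have key : ∀ b : BanachCurve E M, acc E' (b.map f hf).toFun 0 = _ := fun b =>
    acc_comp (f := f) isOpen_Ioo b.smooth isOpen_univ hf.contMDiffOn
      b.zero_mem (mem_univ _)
  rw [key, key, h]

/-- The map of second order tangent bundles induced by a smooth map. -/
def BanachSecondTangent.map (f : M → M') (hf : ContMDiff 𝓘(ℝ, E) 𝓘(ℝ, E') ∞ f) :
    BanachSecondTangent E M → BanachSecondTangent E' M' :=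
  Quotient.lift (fun c => BanachSecondTangent.mk (c.map f hf)) fun _ _ h =>
    BanachSecondTangent.mk_map_eq (Quotient.sound h) f hf

end MapSecondTangent

/-! ### Second order tangency for manifolds given by an atlas -/

section TVS

variable {F : Type*} [AddCommGroup F] [Module ℝ F] [TopologicalSpace F]
  {X : Type*} {A : Set (LocalChart F X)}

theorem SmoothCurve.zero_mem (c : SmoothCurve A) : (0 : ℝ) ∈ Ioo (-c.ε) c.ε :=
  ⟨neg_lt_zero.2 c.ε_pos, c.ε_pos⟩

theorem SmoothCurve.exists_smoothIn_zero (c : SmoothCurve A) {e : LocalChart F X} (he : e ∈ A)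
    (hc : c.toFun 0 ∈ e.source) : ∃ δ > 0, (∀ s ∈ Ioo (-δ) δ, c.toFun s ∈ e.source) ∧
      SmoothIn (e.toFun ∘ c.toFun) (Ioo (-δ) δ) := by
  simpa using c.smooth 0 c.zero_mem e he hc

variable [T2Space F]

theorem SmoothIn.hasCurveDerivAt {c : ℝ → F} {s : Set ℝ} (h : SmoothIn c s) {t : ℝ} (ht : t ∈ s) :
    HasCurveDerivAt c (curveDeriv c t) t := by
  obtain ⟨g, rfl, hg⟩ := h
  rw [(hg 0 t ht).curveDeriv_eq]
  exact hg 0 t ht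

theorem SmoothIn.curveDeriv {c : ℝ → F} {s : Set ℝ} (hs : IsOpen s) (h : SmoothIn c s) :
    SmoothIn (curveDeriv c) s := by
  obtain ⟨g, rfl, hg⟩ := h
  -- `g 1` agrees with the derivative only on `s`, whereas the zeroth term of the sequence must
  -- equal it everywhere.
  refine ⟨fun n => if n = 0 then SecondOrder.curveDeriv (g 0) else g (n + 1), if_pos rfl,
    fun n t ht => ?_⟩
  rcases n with _ | n
  · simp only [if_true, zero_add, one_ne_zero, if_false]
    refine (hg 1 t ht).congr ?_
    filter_upwards [hs.mem_nhds ht] with r hr using (hg 0 r hr).curveDeriv_eq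
  · simpa using hg (n + 2) t ht

theorem SmoothCurve.velocity_apply (c : SmoothCurve A) {t : ℝ} (ht : t ∈ Ioo (-c.ε) c.ε) :
    c.velocity.toFun t = Tangent.mk (c.shift t ht) := dif_pos ht

/-- Shifting by time `0` leaves the underlying function unchanged. The lemma serves both for `A` and
for `tangentAtlas A`, applied to velocities. -/
theorem SmoothCurve.velocity_zero_eq_iff {c d : SmoothCurve A} :
    c.velocity.toFun 0 = d.velocity.toFun 0 ↔ tangentSetoid A c d := by
  rw [c.velocity_apply c.zero_mem,
    d.velocity_apply d.zero_mem]
  refine Quotient.eq.trans ?_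
  have key : ∀ b : SmoothCurve A, (b.shift 0 b.zero_mem).toFun = b.toFun := fun b =>
    funext fun s => congrArg b.toFun (zero_add s)
  change ((c.shift 0 c.zero_mem).toFun 0 = (d.shift 0 d.zero_mem).toFun 0 ∧ ∀ e ∈ A,
    (c.shift 0 c.zero_mem).toFun 0 ∈ e.source →
      curveDeriv (e.toFun ∘ (c.shift 0 c.zero_mem).toFun) 0 =
        curveDeriv (e.toFun ∘ (d.shift 0 d.zero_mem).toFun) 0) ↔ _
  rw [key c, key d]
  rfl

/-- In the tangent chart over `e` the velocity is, near `0`, the pair formed by the representative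
of `c` and its derivative. -/
theorem SmoothCurve.hasCurveDerivAt_velocity (c : SmoothCurve A) {e : LocalChart F X} (he : e ∈ A)
    (hc : c.toFun 0 ∈ e.source) :
    HasCurveDerivAt ((tangentChart e he).toFun ∘ c.velocity.toFun)
      (curveDeriv (e.toFun ∘ c.toFun) 0, curveDeriv (curveDeriv (e.toFun ∘ c.toFun)) 0) 0 := by
  obtain ⟨δ, hδ, hs, hsm⟩ := c.exists_smoothIn_zero he hc
  have h0 : (0 : ℝ) ∈ Ioo (-δ) δ := ⟨neg_lt_zero.2 hδ, hδ⟩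
  refine ((hsm.hasCurveDerivAt h0).prodMk
    ((hsm.curveDeriv isOpen_Ioo).hasCurveDerivAt h0)).congr ?_
  filter_upwards [isOpen_Ioo.mem_nhds h0, isOpen_Ioo.mem_nhds c.zero_mem] with s h1 h2
  simp only [Function.comp_apply]
  rw [c.velocity_apply h2, tangentChart_mk_shift c s h2 e he (hs s h1)]

/-- Every chart of `TX` lies over a chart of `X`, so tangency of the velocities adds only the second
derivatives in the charts of `X`. -/
theorem SecondTangent.mk_eq_iff {c d : SmoothCurve A} :
    SecondTangent.mk c = SecondTangent.mk d ↔ c.toFun 0 = d.toFun 0 ∧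
      ∀ e ∈ A, c.toFun 0 ∈ e.source →
        curveDeriv (e.toFun ∘ c.toFun) 0 = curveDeriv (e.toFun ∘ d.toFun) 0 ∧
        curveDeriv (curveDeriv (e.toFun ∘ c.toFun)) 0 =
          curveDeriv (curveDeriv (e.toFun ∘ d.toFun)) 0 := by
  have hvel : ∀ b : SmoothCurve A, (b.velocity.toFun 0).proj = b.toFun 0 := fun b => by
    rw [b.velocity_apply b.zero_mem]
    change b.toFun (0 + 0) = _
    rw [add_zero]
  refine Quotient.eq.trans ?_
  change (_ ∧ _) ↔ _
  rw [SmoothCurve.velocity_zero_eq_iff, SmoothCurve.velocity_zero_eq_iff]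
  constructor
  · rintro ⟨⟨h0, h1⟩, -, h2⟩
    refine ⟨h0, fun e he hc => ⟨h1 e he hc, ?_⟩⟩
    have h3 := h2 _ ⟨e, he, rfl⟩ (show (c.velocity.toFun 0).proj ∈ e.source by rwa [hvel c])
    rw [(c.hasCurveDerivAt_velocity he hc).curveDeriv_eq,
      (d.hasCurveDerivAt_velocity he (h0 ▸ hc)).curveDeriv_eq] at h3
    exact (Prod.ext_iff.1 h3).2
  · rintro ⟨h0, h1⟩
    have h2 : tangentSetoid A c d := ⟨h0, fun e he hc => (h1 e he hc).1⟩
    refine ⟨h2, SmoothCurve.velocity_zero_eq_iff.2 h2, ?_⟩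
    rintro k ⟨e, he, rfl⟩ hk
    have hc : c.toFun 0 ∈ e.source := hvel c ▸ hk
    rw [(c.hasCurveDerivAt_velocity he hc).curveDeriv_eq,
      (d.hasCurveDerivAt_velocity he (h0 ▸ hc)).curveDeriv_eq]
    exact Prod.ext (h1 e he hc).1 (h1 e he hc).2

end TVS

/-! ### Calculus in the projective limit, coordinate by coordinate -/

section Limit

universe u v

variable {E : ℕ → Type u} [∀ i, NormedAddCommGroup (E i)] [∀ i, NormedSpace ℝ (E i)]
  {M : ℕ → Type v} [∀ i, TopologicalSpace (M i)] [∀ i, ChartedSpace (E i) (M i)]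
  {ρ : ∀ ⦃i j : ℕ⦄, i ≤ j → E j →L[ℝ] E i} {φ : ∀ ⦃i j : ℕ⦄, i ≤ j → M j → M i}

theorem HasCurveDerivAt.coord {c : ℝ → modelLimit ρ} {v : modelLimit ρ} {t : ℝ}
    (h : HasCurveDerivAt c v t) (i : ℕ) : HasDerivAt (fun s => (c s).1 i) (v.1 i) t := by
  have h1 : Continuous fun x : modelLimit ρ => x.1 i :=
    (continuous_apply i).comp continuous_subtype_val
  exact hasDerivAt_iff_tendsto_slope_zero.2 ((h1.tendsto _).comp h)

/-- A curve in the limit of Banach spaces is differentiable if its coordinates are. -/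
theorem hasCurveDerivAt_of_coord {c : ℝ → modelLimit ρ} {v : modelLimit ρ} {t : ℝ}
    (h : ∀ i, HasDerivAt (fun s => (c s).1 i) (v.1 i) t) : HasCurveDerivAt c v t :=
  tendsto_subtype_rng.2 (tendsto_pi_nhds.2 fun i => hasDerivAt_iff_tendsto_slope_zero.1 (h i))

/-- The coordinate derivatives are compatible because `ρ` is linear and continuous, hence commutes
with differentiation. They therefore form a vector of `𝔽`, which is the derivative. -/
theorem hasCurveDerivAt_of_contDiffOn_coord {c : ℝ → modelLimit ρ} {s : Set ℝ} (hs : IsOpen s)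
    (h : ∀ i, ContDiffOn ℝ ∞ (fun t => (c t).1 i) s) {t : ℝ} (ht : t ∈ s) :
    HasCurveDerivAt c (curveDeriv c t) t := by
  have hd : ∀ i, HasDerivAt (fun t => (c t).1 i) (deriv (fun t => (c t).1 i) t) t := fun i =>
    (((h i).contDiffAt (hs.mem_nhds ht)).differentiableAt (by simp)).hasDerivAt
  have hv : (fun i => deriv (fun t => (c t).1 i) t) ∈ modelLimit ρ := by
    intro i j hij
    have h1 := (ρ hij).hasFDerivAt.comp_hasDerivAt t (hd j)
    have h2 : (ρ hij ∘ fun t => (c t).1 j) = fun t => (c t).1 i := by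
      funext r; exact (c r).2 hij
    rw [h2] at h1
    exact h1.deriv.symm
  have key : HasCurveDerivAt c ⟨_, hv⟩ t := hasCurveDerivAt_of_coord hd
  rwa [key.curveDeriv_eq]

/-- A curve in the limit of Banach spaces is smooth if its coordinates are. -/
theorem smoothIn_of_contDiffOn_coord {c : ℝ → modelLimit ρ} {s : Set ℝ} (hs : IsOpen s)
    (h : ∀ i, ContDiffOn ℝ ∞ (fun t => (c t).1 i) s) : SmoothIn c s := by
  -- The successive derivatives are the iterates of `curveDeriv`; each again has smooth coordinates
  -- on `s`.
  have key : ∀ n i, ContDiffOn ℝ ∞ (fun t => (curveDeriv^[n] c t).1 i) s := by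
    intro n
    induction n with
    | zero => exact h
    | succ n ih =>
      intro i
      rw [Function.iterate_succ_apply']
      refine (((contDiffOn_infty_iff_deriv_of_isOpen hs).1 (ih i)).2).congr fun t ht => ?_
      exact ((hasCurveDerivAt_of_contDiffOn_coord hs ih ht).coord i).deriv.symm
  refine ⟨fun n => curveDeriv^[n] c, rfl, fun n t ht => ?_⟩
  change HasCurveDerivAt _ (curveDeriv^[n + 1] c t) t
  rw [Function.iterate_succ_apply']
  exact hasCurveDerivAt_of_contDiffOn_coord hs (key n) ht

/-- The first two derivatives of a curve of the limit, read in a limit chart, are given by those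
of its components. -/
theorem SmoothCurve.deriv_coord (c : SmoothCurve (limitAtlas ρ φ))
    {e : OpenPartialHomeomorph (projLimit φ) (modelLimit ρ)} (he : e ∈ limitCharts ρ φ)
    (hc : c.toFun 0 ∈ e.source) (i : ℕ) {ψ : M i → E i}
    (hval : ∀ x ∈ e.source, (e x).1 i = ψ (x.1 i)) :
    deriv (ψ ∘ fun t => (c.toFun t).1 i) 0 = (curveDeriv (e ∘ c.toFun) 0).1 i ∧
      deriv (deriv (ψ ∘ fun t => (c.toFun t).1 i)) 0 =
        (curveDeriv (curveDeriv (e ∘ c.toFun)) 0).1 i := by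
  obtain ⟨δ, hδ, hs, hsm⟩ := c.exists_smoothIn_zero (e := ⟨e.source, e⟩) ⟨e, he, rfl⟩ hc
  have h0 : (0 : ℝ) ∈ Ioo (-δ) δ := ⟨neg_lt_zero.2 hδ, hδ⟩
  -- First derivatives are compared on the whole interval, since the second derivative depends on
  -- their germ at `0`.
  have h1 : ∀ t ∈ Ioo (-δ) δ, deriv (ψ ∘ fun t => (c.toFun t).1 i) t =
      (curveDeriv (e ∘ c.toFun) t).1 i := by
    intro t ht
    rw [← ((hsm.hasCurveDerivAt ht).coord i).deriv]
    refine EventuallyEq.deriv_eq ?_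
    filter_upwards [isOpen_Ioo.mem_nhds ht] with r hr using (hval _ (hs r hr)).symm
  refine ⟨h1 0 h0, ?_⟩
  rw [← (((hsm.curveDeriv isOpen_Ioo).hasCurveDerivAt h0).coord i).deriv]
  refine EventuallyEq.deriv_eq ?_
  filter_upwards [isOpen_Ioo.mem_nhds h0] with r hr using h1 r hr

/-- A curve in the target of a limit chart with smooth coordinates comes from a smooth curve of
the limit manifold. -/
theorem exists_smoothCurve {e : OpenPartialHomeomorph (projLimit φ) (modelLimit ρ)}
    (he : e ∈ limitCharts ρ φ) {p : ℝ → modelLimit ρ} (hp : Continuous p)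
    (hsm : ∀ i, ContDiff ℝ ∞ fun t => (p t).1 i) (h0 : p 0 ∈ e.target) :
    ∃ c : SmoothCurve (limitAtlas ρ φ), c.toFun = e.symm ∘ p := by
  obtain ⟨ε, hε, hball⟩ := Metric.isOpen_iff.1 (e.open_target.preimage hp) 0 h0
  rw [Real.ball_eq_Ioo, zero_sub, zero_add] at hball
  obtain ⟨ψ, hψ, -, hsrc, hval⟩ := he
  have hcont : ContinuousOn (e.symm ∘ p) (Ioo (-ε) ε) :=
    e.continuousOn_symm.comp hp.continuousOn hball
  have hcoord : ∀ i, ContMDiffOn 𝓘(ℝ, ℝ) 𝓘(ℝ, E i) ∞ (fun t => (e.symm (p t)).1 i)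
      (Ioo (-ε) ε) := by
    intro i
    have h1 : ∀ t ∈ Ioo (-ε) ε, (p t).1 i = ψ i ((e.symm (p t)).1 i) := fun t ht => by
      rw [← hval _ (e.map_target (hball ht)) i, e.right_inv (hball ht)]
    have h2 : ∀ t ∈ Ioo (-ε) ε, (e.symm (p t)).1 i ∈ (ψ i).source := fun t ht =>
      (hsrc _).1 (e.map_target (hball ht)) i
    refine ((contMDiffOn_symm_of_mem_maximalAtlas (hψ i)).comp
      (hsm i).contMDiff.contMDiffOn fun t ht => ?_).congr fun t ht => ?_
    · rw [mem_preimage, h1 t ht]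
      exact (ψ i).map_source (h2 t ht)
    · rw [Function.comp_apply, h1 t ht, (ψ i).left_inv (h2 t ht)]
  refine ⟨⟨e.symm ∘ p, ε, hε, ?_⟩, rfl⟩
  -- Smoothness is required in every limit chart `e'`, not only in `e`. It is checked on
  -- coordinates, through the Banach charts `ψ' i`, so no transition map of `𝔽` has to be
  -- differentiated.
  rintro t ht _ ⟨e', ⟨ψ', hψ', -, hsrc', hval'⟩, rfl⟩ hte
  obtain ⟨δ, hδ, hsub⟩ := Metric.isOpen_iff.1
    (hcont.isOpen_inter_preimage isOpen_Ioo e'.open_source) t ⟨ht, hte⟩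
  rw [Real.ball_eq_Ioo] at hsub
  refine ⟨δ, hδ, fun s hs => (hsub hs).2, smoothIn_of_contDiffOn_coord isOpen_Ioo fun i => ?_⟩
  refine (contMDiffOn_iff_contDiffOn.1 ((contMDiffOn_of_mem_maximalAtlas (hψ' i)).comp
    ((hcoord i).mono fun s hs => (hsub hs).1) fun s hs => ?_)).congr fun s hs => ?_
  · exact (hsrc' _).1 (hsub hs).2 i
  · exact hval' _ (hsub hs).2 i

/-! ### Comparison of the limit with its components -/

variable [∀ i, IsManifold 𝓘(ℝ, E i) ∞ (M i)]

theorem SecondTangent.mk_eq_iff_component (hM : IsManifoldSystem ρ φ)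
    {c d : SmoothCurve (limitAtlas ρ φ)} :
    SecondTangent.mk c = SecondTangent.mk d ↔
      ∀ i, BanachSecondTangent.mk (c.component hM i) =
        BanachSecondTangent.mk (d.component hM i) := by
  rw [SecondTangent.mk_eq_iff]
  constructor
  · rintro ⟨h0, h⟩ i
    -- One limit chart suffices here, since equality in the Banach manifold `M i` can be tested in a
    -- single chart. The converse has to treat all limit charts.
    obtain ⟨e, he, hce⟩ := hM.exists_chart (c.toFun 0)
    obtain ⟨h1, h2⟩ := h ⟨e.source, e⟩ ⟨e, he, rfl⟩ hce
    have hde : d.toFun 0 ∈ e.source := h0 ▸ hce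
    have he' := he
    obtain ⟨ψ, hψ, -, hsrc, hval⟩ := he'
    rw [BanachSecondTangent.mk_eq_iff_chart (hψ i) ((hsrc _).1 hce i)
      (congrArg (fun x : projLimit φ => x.1 i) h0)]
    have hc' := c.deriv_coord he hce i (ψ := ψ i) fun x hx => hval x hx i
    have hd' := d.deriv_coord he hde i (ψ := ψ i) fun x hx => hval x hx i
    exact ⟨hc'.1.trans ((congrArg (fun x : modelLimit ρ => x.1 i) h1).trans hd'.1.symm),
      hc'.2.trans ((congrArg (fun x : modelLimit ρ => x.1 i) h2).trans hd'.2.symm)⟩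
  · intro h
    have h0 : c.toFun 0 = d.toFun 0 :=
      Subtype.ext (funext fun i => BanachSecondTangent.toFun_zero_eq (h i))
    refine ⟨h0, ?_⟩
    rintro _ ⟨e, he, rfl⟩ hce
    have hde : d.toFun 0 ∈ e.source := h0 ▸ hce
    have he' := he
    obtain ⟨ψ, hψ, -, hsrc, hval⟩ := he'
    have h1 := fun i => (BanachSecondTangent.mk_eq_iff_chart (hψ i) ((hsrc _).1 hce i)
      (congrArg (fun x : projLimit φ => x.1 i) h0)).1 (h i)
    have hc' := fun i => c.deriv_coord he hce i (ψ := ψ i) fun x hx => hval x hx i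
    have hd' := fun i => d.deriv_coord he hde i (ψ := ψ i) fun x hx => hval x hx i
    exact ⟨Subtype.ext (funext fun i => (hc' i).1.symm.trans ((h1 i).1.trans (hd' i).1)),
      Subtype.ext (funext fun i => (hc' i).2.symm.trans ((h1 i).2.trans (hd' i).2))⟩

/-- A compatible family of second order tangent vectors is represented by a curve of the limit. -/
theorem exists_smoothCurve_component_eq (hM : IsManifoldSystem ρ φ)
    (c : ∀ i, BanachCurve (E i) (M i))
    (hc : ∀ ⦃i j : ℕ⦄ (h : i ≤ j), BanachSecondTangent.mk ((c j).map (φ h) (hM.smooth h)) =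
      BanachSecondTangent.mk (c i)) :
    ∃ b : SmoothCurve (limitAtlas ρ φ), ∀ i,
      BanachSecondTangent.mk (b.component hM i) = BanachSecondTangent.mk (c i) := by
  let x : projLimit φ := ⟨fun i => (c i).toFun 0, fun i j h =>
    BanachSecondTangent.toFun_zero_eq (hc h)⟩
  obtain ⟨e, he, hxe⟩ := hM.exists_chart x
  have he' := he
  obtain ⟨ψ, hψ, hcomp, hsrc, hval⟩ := he'
  have hxψ : ∀ i, (c i).toFun 0 ∈ (ψ i).source := (hsrc x).1 hxe
  let w : ∀ i, Set ℝ := fun i => Ioo (-(c i).ε) (c i).ε ∩ (c i).toFun ⁻¹' (ψ i).source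
  have hw : ∀ i, IsOpen (w i) := fun i =>
    (c i).smooth.continuousOn.isOpen_inter_preimage isOpen_Ioo (ψ i).open_source
  have h0w : ∀ i, (0 : ℝ) ∈ w i := fun i => ⟨(c i).zero_mem, hxψ i⟩
  have hsm : ∀ i, ContDiffOn ℝ ∞ (ψ i ∘ (c i).toFun) (w i) := fun i =>
    contMDiffOn_iff_contDiffOn.1 ((contMDiffOn_of_mem_maximalAtlas (hψ i)).comp
      ((c i).smooth.mono inter_subset_left) inter_subset_right)
  have hsm' : ∀ i, ContDiffOn ℝ ∞ (deriv (ψ i ∘ (c i).toFun)) (w i) := fun i =>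
    ((contDiffOn_infty_iff_deriv_of_isOpen (hw i)).1 (hsm i)).2
  have hd : ∀ i, ∀ t ∈ w i, HasDerivAt (ψ i ∘ (c i).toFun) (deriv (ψ i ∘ (c i).toFun) t) t :=
    fun i t ht => (((hsm i).contDiffAt ((hw i).mem_nhds ht)).differentiableAt (by simp)).hasDerivAt
  have hd' : ∀ i, ∀ t ∈ w i, HasDerivAt (deriv (ψ i ∘ (c i).toFun))
      (deriv (deriv (ψ i ∘ (c i).toFun)) t) t := fun i t ht =>
    (((hsm' i).contDiffAt ((hw i).mem_nhds ht)).differentiableAt (by simp)).hasDerivAt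
  have hmap : ∀ ⦃i j : ℕ⦄ (h : i ≤ j), ∀ t ∈ w j,
      -- In the charts `ψ`, the map `φ h` becomes the linear map `ρ h`, which passes through
      -- derivatives. The identity is needed for `t` near `0` so that it can be differentiated once
      -- more.
      deriv (ψ i ∘ ((c j).map (φ h) (hM.smooth h)).toFun) t =
        ρ h (deriv (ψ j ∘ (c j).toFun) t) := by
    intro i j h t ht
    refine HasDerivAt.deriv (((ρ h).hasFDerivAt.comp_hasDerivAt t (hd j t ht)).congr_of_eventuallyEq
      ?_)
    filter_upwards [(hw j).mem_nhds ht] with r hr using (hcomp h _ hr.2).2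
  have hmap' : ∀ ⦃i j : ℕ⦄ (h : i ≤ j),
      deriv (deriv (ψ i ∘ ((c j).map (φ h) (hM.smooth h)).toFun)) 0 =
        ρ h (deriv (deriv (ψ j ∘ (c j).toFun)) 0) := by
    intro i j h
    refine HasDerivAt.deriv (((ρ h).hasFDerivAt.comp_hasDerivAt 0
      (hd' j 0 (h0w j))).congr_of_eventuallyEq ?_)
    filter_upwards [(hw j).mem_nhds (h0w j)] with r hr using hmap h r hr
  -- Compatibility of the classes becomes equality of first and second derivatives; this makes `v₁`
  -- and `v₂` elements of `𝔽`.
  have hchart := fun ⦃i j : ℕ⦄ (h : i ≤ j) => (BanachSecondTangent.mk_eq_iff_chart (hψ i)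
    (c := (c j).map (φ h) (hM.smooth h)) (hcomp h _ (hxψ j)).1 (x.2 h)).1 (hc h)
  let v₁ : modelLimit ρ := ⟨fun i => deriv (ψ i ∘ (c i).toFun) 0, fun i j h =>
    (hmap h 0 (h0w j)).symm.trans (hchart h).1⟩
  let v₂ : modelLimit ρ := ⟨fun i => deriv (deriv (ψ i ∘ (c i).toFun)) 0, fun i j h =>
    (hmap' h).symm.trans (hchart h).2⟩
  -- The quadratic curve with prescribed 2-jet; the factor `1 / 2` makes its second derivative
  -- exactly `v₂`.
  let p : ℝ → modelLimit ρ := fun t => e x + t • v₁ + (t ^ 2 / 2) • v₂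
  have hp0 : p 0 = e x := by simp [p]
  have hp : Continuous p := by fun_prop
  have hpi : ∀ i, (fun t => (p t).1 i) = fun t => (e x).1 i + t • v₁.1 i + (t ^ 2 / 2) • v₂.1 i :=
    fun i => rfl
  have hpd : ∀ i, deriv (fun t => (p t).1 i) = fun t => v₁.1 i + t • v₂.1 i := by
    intro i
    funext t
    rw [hpi]
    have h1 : HasDerivAt (fun t : ℝ => t ^ 2 / 2) t t := by
      simpa using (hasDerivAt_pow 2 t).div_const 2
    have h2 := (((hasDerivAt_id t).smul_const (v₁.1 i)).const_add ((e x).1 i)).add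
      (h1.smul_const (v₂.1 i))
    rw [one_smul] at h2
    exact h2.deriv
  have hpdd : ∀ i, deriv (deriv fun t => (p t).1 i) 0 = v₂.1 i := by
    intro i
    rw [hpd]
    have h2 := ((hasDerivAt_id (0 : ℝ)).smul_const (v₂.1 i)).const_add (v₁.1 i)
    rw [one_smul] at h2
    exact h2.deriv
  obtain ⟨b, hb⟩ := exists_smoothCurve he hp (fun i => by rw [hpi]; fun_prop)
    (hp0 ▸ e.map_source hxe)
  have hb0 : b.toFun 0 = x := by
    rw [hb, Function.comp_apply, hp0, e.left_inv hxe]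
  refine ⟨b, fun i => ?_⟩
  have hbi : (b.component hM i).toFun 0 = (c i).toFun 0 :=
    congrArg (fun y : projLimit φ => y.1 i) hb0
  have hev : ψ i ∘ (b.component hM i).toFun =ᶠ[𝓝 0] fun t => (p t).1 i := by
    have h1 : ∀ᶠ t in 𝓝 (0 : ℝ), p t ∈ e.target :=
      hp.continuousAt.eventually (e.open_target.mem_nhds (hp0 ▸ e.map_source hxe))
    filter_upwards [h1] with t ht
    have h2 : b.toFun t = e.symm (p t) := by rw [hb]; rfl
    change ψ i ((b.toFun t).1 i) = _
    rw [h2, ← hval _ (e.map_target ht) i, e.right_inv ht]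
  rw [BanachSecondTangent.mk_eq_iff_chart (hψ i) (hbi ▸ hxψ i) hbi]
  refine ⟨?_, ?_⟩
  · rw [hev.deriv_eq, hpd]
    simp [v₁]
  · rw [hev.deriv.deriv_eq, hpdd]

end Limit

end SecondOrder

/-! ### The projective system and the bijection -/

theorem proposition3p1 {E : ℕ → Type*} [∀ i, NormedAddCommGroup (E i)]
    [∀ i, NormedSpace ℝ (E i)] [∀ i, CompleteSpace (E i)]
    {M : ℕ → Type*} [∀ i, TopologicalSpace (M i)] [∀ i, ChartedSpace (E i) (M i)]
    [∀ i, IsManifold 𝓘(ℝ, E i) ∞ (M i)]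
    (ρ : ∀ ⦃i j : ℕ⦄, i ≤ j → E j →L[ℝ] E i) (φ : ∀ ⦃i j : ℕ⦄, i ≤ j → M j → M i)
    (hM : SecondOrder.IsManifoldSystem ρ φ) :
    ∃ g : ∀ ⦃i j : ℕ⦄, i ≤ j → SecondOrder.BanachSecondTangent (E j) (M j) →
        SecondOrder.BanachSecondTangent (E i) (M i),
      (∀ ⦃i j : ℕ⦄ (h : i ≤ j) (c : SecondOrder.BanachCurve (E j) (M j)),
        g h (SecondOrder.BanachSecondTangent.mk c) =
          SecondOrder.BanachSecondTangent.mk (c.map (φ h) (hM.smooth h))) ∧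
      InverseSystem (F := fun i => SecondOrder.BanachSecondTangent (E i) (M i)) g ∧
      ∃ Φ : SecondOrder.SecondTangent (SecondOrder.limitAtlas ρ φ) → SecondOrder.projLimit g,
        (∀ (c : SecondOrder.SmoothCurve (SecondOrder.limitAtlas ρ φ)) (i : ℕ),
          (Φ (SecondOrder.SecondTangent.mk c)).1 i =
            SecondOrder.BanachSecondTangent.mk (c.component hM i)) ∧
        Function.Bijective Φ := by
  refine ⟨fun i j h => SecondOrder.BanachSecondTangent.map (φ h) (hM.smooth h),
    fun i j h c => rfl, ⟨?_, ?_⟩, ?_⟩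
  · rintro i ⟨c⟩
    refine congrArg SecondOrder.BanachSecondTangent.mk ?_
    simp only [SecondOrder.BanachCurve.map]
    congr 1
    funext t
    exact hM.system.map_self (c.toFun t)
  · rintro i j k hij hjk ⟨c⟩
    refine congrArg SecondOrder.BanachSecondTangent.mk ?_
    simp only [SecondOrder.BanachCurve.map]
    congr 1
    funext t
    exact hM.system.map_map hij hjk (c.toFun t)
  · have hmem : ∀ c : SecondOrder.SmoothCurve (SecondOrder.limitAtlas ρ φ),
        (fun i => SecondOrder.BanachSecondTangent.mk (c.component hM i)) ∈
          SecondOrder.projLimit fun i j (h : i ≤ j) =>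
            SecondOrder.BanachSecondTangent.map (φ h) (hM.smooth h) := by
      intro c i j h
      refine congrArg SecondOrder.BanachSecondTangent.mk ?_
      simp only [SecondOrder.BanachCurve.map, SecondOrder.SmoothCurve.component]
      congr 1
      funext t
      exact (c.toFun t).2 h
    refine ⟨Quotient.lift (fun c => ⟨_, hmem c⟩) fun c d h => Subtype.ext (funext
      ((SecondOrder.SecondTangent.mk_eq_iff_component hM).1 (Quotient.sound h))),
      fun c i => rfl, ?_, ?_⟩
    · rintro ⟨c⟩ ⟨d⟩ h
      exact (SecondOrder.SecondTangent.mk_eq_iff_component hM).2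
        fun i => congrFun (congrArg Subtype.val h) i
    · rintro ⟨z, hz⟩
      -- The representatives are chosen independently at each level; only their classes are
      -- compatible.
      choose c hc using fun i => Quotient.exists_rep (z i)
      obtain ⟨b, hb⟩ := SecondOrder.exists_smoothCurve_component_eq hM c fun i j h => by
        have h1 := hz h
        rw [← hc i, ← hc j] at h1
        exact h1
      exact ⟨SecondOrder.SecondTangent.mk b, Subtype.ext (funext fun i => (hb i).trans (hc i))⟩
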